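/- Consider one bosonic mode with annihilation operator $a$, $[a,a^\dagger]=1$, and Fock basis $\{|n\rangle\}_{n\ge 0}$. A state is a positive trace-class operator $\rho$ with $\operatorname{Tr}\rho=1$; its characteristic function is $\chi_\rho(\xi)=\operatorname{Tr}\bigl(\rho\,e^{\xi a^\dagger-\xi^* a}\bigr)$, $\xi\in\mathbb C$, and its von Neumann entropy is $S(\rho)=-\operatorname{Tr}(\rho\ln\rho)\in[0,\infty]$. For $\bar n\ge 0$ let $$\rho^{\mathrm{th}}_{\bar n}=\sum_{n\ge 0}\frac{\bar n^{\,n}}{(1+\bar n)^{n+1}}|n\rangle\langle n|,\qquad g(\bar n)=(\bar n+1)\ln(\bar n+1)-\bar n\ln\bar n$$ be the thermal state of mean photon number $\bar n$ and its entropy; $g$ is a bijection of $[0,\infty)$ onto itself. Single-mode gauge-covariant bosonic Gaussian channels are the maps $\Phi$ from states to states given by $$\chi_{\Phi(\rho)}(\xi)=\chi_\rho(\sqrt{\tau}\,\xi)\,e^{-y|\xi|^2/2},\qquad \tau>0,\quad y\ge|\tau-1|,$$ and single-mode gauge-contravariant ones are the maps given by $$\chi_{\Phi(\rho)}(\xi)=\chi_\rho(-\sqrt{|\tau|}\,\xi^*)\,e^{-y|\xi|^2/2},\qquad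 \tau<0,\quad y\ge|\tau-1|.$$ (A state is determined by its characteristic function, so these identities determine $\Phi$.) Say that thermal inputs minimize the output entropy of $\Phi$ if, for every $S_0\in[0,\infty)$ and every state $\rho$ with $S(\rho)=S_0$, $$S(\Phi(\rho))\ \ge\ S\bigl(\Phi(\rho^{\mathrm{th}}_{g^{-1}(S_0)})\bigr).$$ Theorem. If thermal inputs minimize the output entropy of every single-mode gauge-covariant bosonic Gaussian channel, then thermal inputs minimize the output entropy of every single-mode gauge-contravariant bosonic Gaussian channel. -/

import Mathlib

open scoped NNReal ENNReal ComplexConjugate Nat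

noncomputable section

/-- The Hilbert space of one bosonic mode, realised as `ℓ²(ℕ)` through its Fock basis. -/
abbrev ModeSpace : Type := lp (fun _ : ℕ => ℂ) 2

/-- The Fock (photon-number) state `|n⟩`. -/
def fock (n : ℕ) : ModeSpace := lp.single 2 n (1 : ℂ)

/-- A quantum state of the mode: a positive operator of trace one. For a positive operator,
convergence of the sum of its diagonal entries is the trace-class property. -/
structure QState where
  op : ModeSpace →L[ℂ] ModeSpace
  isPositive : op.IsPositive
  hasTrace_one : HasSum (fun n : ℕ => inner ℂ (fock n) (op (fock n))) 1

/-- The operator `-T ln T` of a positive bounded operator `T`, by the continuous functional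
calculus (`Real.negMulLog x = -x ln x`, with value `0` at `x = 0`). -/
def opNegMulLog {E : Type*} [NormedAddCommGroup E] [InnerProductSpace ℂ E] [CompleteSpace E]
    (T : E →L[ℂ] E) : E →L[ℂ] E :=
  cfc Real.negMulLog T

/-- The von Neumann entropy `S(ρ) = -Tr (ρ ln ρ)`, possibly infinite. The diagonal entries are
nonnegative, since `0 ≤ ρ ≤ 1`. -/
def QState.entropy (ρ : QState) : ℝ≥0∞ :=
  ∑' n : ℕ, ENNReal.ofReal (inner ℂ (fock n) (opNegMulLog ρ.op (fock n))).re

/-- Vectors with finitely many photons: the common invariant domain of the creation and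
annihilation operators. `Finsupp.single n 1` stands for `|n⟩`. -/
abbrev FiniteModeSpace : Type := ℕ →₀ ℂ

/-- The inclusion of the finite-photon-number vectors in the Hilbert space. -/
def FiniteModeSpace.toMode : FiniteModeSpace →ₗ[ℂ] ModeSpace :=
  Finsupp.linearCombination ℂ fock

/-- The annihilation operator `a`, with `a |n⟩ = √n |n - 1⟩` and `a |0⟩ = 0`. -/
def annihilation : Module.End ℂ FiniteModeSpace :=
  Finsupp.linearCombination ℂ
    (fun n : ℕ => ((Real.sqrt n : ℝ) : ℂ) • (Finsupp.single (n - 1) 1 : FiniteModeSpace))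

/-- The creation operator `a†`, with `a† |n⟩ = √(n + 1) |n + 1⟩`. -/
def creation : Module.End ℂ FiniteModeSpace :=
  Finsupp.linearCombination ℂ
    (fun n : ℕ => ((Real.sqrt (n + 1 : ℕ) : ℝ) : ℂ) •
      (Finsupp.single (n + 1) 1 : FiniteModeSpace))

/-- The vector `e^{ξ a† - ξ* a} |n⟩`, by the exponential series, which converges in norm on
finite-photon-number vectors. -/
def displacedFock (ξ : ℂ) (n : ℕ) : ModeSpace :=
  ∑' k : ℕ, ((k ! : ℂ))⁻¹ •
    FiniteModeSpace.toMode (((ξ • creation + (-conj ξ) • annihilation) ^ k) (Finsupp.single n 1))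

/-- The characteristic function `χ_ρ(ξ) = Tr (ρ e^{ξ a† - ξ* a})`. -/
def QState.charFun (ρ : QState) (ξ : ℂ) : ℂ :=
  ∑' n : ℕ, inner ℂ (fock n) (ρ.op (displacedFock ξ n))

/-- The gauge-covariant Gaussian channel with parameters `τ > 0` and `y ≥ |τ - 1|`, given by its
action on characteristic functions. A state is determined by its characteristic function, so this
fixes `Φ` completely. -/
def IsGaugeCovariant (τ y : ℝ) (Φ : QState → QState) : Prop :=
  0 < τ ∧ |τ - 1| ≤ y ∧
    ∀ (ρ : QState) (ξ : ℂ), (Φ ρ).charFun ξ =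
      ρ.charFun ((Real.sqrt τ : ℝ) * ξ) * (Real.exp (-y * ‖ξ‖ ^ 2 / 2) : ℝ)

/-- The gauge-contravariant Gaussian channel with parameters `τ < 0` and `y ≥ |τ - 1|`, given by
its action on characteristic functions. -/
def IsGaugeContravariant (τ y : ℝ) (Φ : QState → QState) : Prop :=
  τ < 0 ∧ |τ - 1| ≤ y ∧
    ∀ (ρ : QState) (ξ : ℂ), (Φ ρ).charFun ξ =
      ρ.charFun (-((Real.sqrt |τ| : ℝ) * conj ξ)) * (Real.exp (-y * ‖ξ‖ ^ 2 / 2) : ℝ)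

/-- The weights `n̄ⁿ / (1 + n̄)ⁿ⁺¹` of the Bose-Einstein distribution of mean `n̄`. -/
def thermalWeight (nbar : ℝ≥0) (n : ℕ) : ℝ := (nbar : ℝ) ^ n / (1 + nbar) ^ (n + 1)

theorem thermalWeight_nonneg (nbar : ℝ≥0) (n : ℕ) : 0 ≤ thermalWeight nbar n := by
  unfold thermalWeight; positivity

theorem hasSum_thermalWeight (nbar : ℝ≥0) : HasSum (thermalWeight nbar) 1 := by
  have h0 : (0 : ℝ) ≤ nbar := nbar.2
  have h1 : (0 : ℝ) < 1 + nbar := by positivity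
  have h := (hasSum_geometric_of_lt_one (r := (nbar : ℝ) / (1 + nbar)) (by positivity)
    ((div_lt_one h1).2 (by linarith))).mul_left (1 + (nbar : ℝ))⁻¹
  have e1 : (fun n : ℕ => (1 + (nbar : ℝ))⁻¹ * ((nbar : ℝ) / (1 + nbar)) ^ n)
      = thermalWeight nbar := by
    funext n
    simp only [thermalWeight, div_pow, pow_succ]
    field_simp
  have e2 : (1 + (nbar : ℝ))⁻¹ * (1 - (nbar : ℝ) / (1 + nbar))⁻¹ = 1 := by
    have h2 : 1 - (nbar : ℝ) / (1 + nbar) = (1 + (nbar : ℝ))⁻¹ := by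
      field_simp
      ring
    rw [h2, inv_inv, inv_mul_cancel₀ h1.ne']
  rwa [e1, e2] at h

theorem inner_fock (m n : ℕ) : inner ℂ (fock m) (fock n) = if m = n then (1 : ℂ) else 0 := by
  simp [fock, lp.inner_single_left, lp.single_apply, Pi.single_apply]

theorem norm_fock (n : ℕ) : ‖fock n‖ = 1 := by
  simp [fock, lp.norm_single]

/-- The operator `∑ₙ n̄ⁿ / (1 + n̄)ⁿ⁺¹ |n⟩⟨n|` (a sum convergent in operator norm). -/
def thermalOp (nbar : ℝ≥0) : ModeSpace →L[ℂ] ModeSpace :=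
  ∑' n : ℕ, (thermalWeight nbar n : ℂ) • InnerProductSpace.rankOne ℂ (fock n) (fock n)

theorem summable_thermalOp (nbar : ℝ≥0) : Summable (fun n : ℕ =>
    (thermalWeight nbar n : ℂ) • InnerProductSpace.rankOne ℂ (fock n) (fock n)) := by
  refine Summable.of_norm ?_
  refine (hasSum_thermalWeight nbar).summable.congr fun n => ?_
  rw [norm_smul, InnerProductSpace.norm_rankOne, norm_fock, Complex.norm_real,
    Real.norm_of_nonneg (thermalWeight_nonneg nbar n)]
  simp

theorem thermalOp_apply_fock (nbar : ℝ≥0) (m : ℕ) :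
    thermalOp nbar (fock m) = (thermalWeight nbar m : ℂ) • fock m := by
  have h := (summable_thermalOp nbar).hasSum.mapL
    (ContinuousLinearMap.apply ℂ ModeSpace (fock m))
  refine h.unique ?_
  convert hasSum_single m ?_ using 1
  · simp [norm_fock, -Complex.coe_smul]
  · intro n hn
    simp [inner_fock, hn]

theorem thermalOp_isPositive (nbar : ℝ≥0) : (thermalOp nbar).IsPositive := by
  rw [← ContinuousLinearMap.nonneg_iff_isPositive]
  refine tsum_nonneg fun n => ?_
  rw [ContinuousLinearMap.nonneg_iff_isPositive]
  refine ContinuousLinearMap.IsPositive.smul_of_nonneg ?_ ?_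
  · exact InnerProductSpace.isPositive_rankOne_self _
  · exact_mod_cast thermalWeight_nonneg nbar n

/-- The thermal state of mean photon number `n̄`. -/
def thermalState (nbar : ℝ≥0) : QState where
  op := thermalOp nbar
  isPositive := thermalOp_isPositive nbar
  hasTrace_one := by
    have h := Complex.hasSum_ofReal.2 (hasSum_thermalWeight nbar)
    simpa [thermalOp_apply_fock, inner_smul_right, norm_fock] using h

/-- The function `g(n̄) = (n̄ + 1) ln (n̄ + 1) - n̄ ln n̄`, with `0 ln 0 = 0`: a bijection of
`[0, ∞)` onto itself, and the entropy of the thermal state of mean photon number `n̄`. -/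
def thermalEntropy (nbar : ℝ≥0) : ℝ :=
  (nbar + 1) * Real.log (nbar + 1) - nbar * Real.log nbar

/-- Among the input states of any given finite entropy `S₀`, the thermal state of mean photon
number `n̄ = g⁻¹(S₀)` minimises the output entropy of `Φ`. -/
def ThermalInputMinimizes (Φ : QState → QState) : Prop :=
  ∀ (S₀ : ℝ≥0) (nbar : ℝ≥0), thermalEntropy nbar = S₀ →
    ∀ ρ : QState, ρ.entropy = S₀ → (Φ (thermalState nbar)).entropy ≤ (Φ ρ).entropy

end

/-!
Transposition in the Fock basis preserves von Neumann entropy and thermal states, and it sends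
`χ_ρ(ξ)` to `χ_ρ(-ξ*)`. Precomposing a gauge-contravariant channel with it therefore gives a
gauge-covariant channel with parameter `|τ|` and the same `y`, and thermal inputs minimize the
output entropy of the one channel as soon as they do so for the other.

On density operators transposition is conjugation by the antiunitary map `J` of complex conjugation,
so it commutes with the functional calculus. As `J D(ξ) J⁻¹ = D(ξ*)` and `D(ξ)† = D(-ξ)`, the rule
for `χ_ρ` amounts to `Tr (D(-ξ*) ρ) = Tr (ρ D(-ξ*))`. This cyclicity holds because `D(ξ)` is bounded
and `√ρ` is Hilbert–Schmidt. That `D(ξ)`, given on Fock states by the exponential series of an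
unbounded skew operator, is isometric follows by multiplying absolutely convergent series.
-/

noncomputable section

section ExpSeries

variable {𝕜 V E : Type*} [RCLike 𝕜] [AddCommGroup V] [Module 𝕜 V]
  [NormedAddCommGroup E] [InnerProductSpace 𝕜 E]

theorem hasSum_inner_prod {α β : Type*} {f : α → E} {g : β → E} {x y : E}
    (hf : HasSum f x) (hg : HasSum g y)
    (hf' : Summable fun a => ‖f a‖) (hg' : Summable fun b => ‖g b‖) :
    HasSum (fun p : α × β => inner 𝕜 (f p.1) (g p.2)) (inner 𝕜 x y) := by
  have hs : Summable fun p : α × β => inner 𝕜 (f p.1) (g p.2) :=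
    .of_norm_bounded (hf'.mul_of_nonneg hg' (fun _ => norm_nonneg _) fun _ => norm_nonneg _)
      fun p => norm_inner_le_norm _ _
  have hrow (a : α) : HasSum (fun b => inner 𝕜 (f a) (g b)) (inner 𝕜 (f a) y) :=
    hg.mapL (innerSL 𝕜 (f a))
  have hcol : HasSum (fun a => inner 𝕜 (f a) y) (inner 𝕜 x y) := hf.mapL (innerSLFlip 𝕜 y)
  exact (hs.hasSum.prod_fiberwise hrow).unique hcol ▸ hs.hasSum

/-- `B` is a formal adjoint of `A` for the inner product that `ι : V → E` pulls back to `V`. Here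
`V` plays the role of a common invariant domain of operators that are unbounded on `E`. -/
def FormallyAdjoint (ι : V →ₗ[𝕜] E) (A B : Module.End 𝕜 V) : Prop :=
  ∀ u v, inner 𝕜 (ι (A u)) (ι v) = inner 𝕜 (ι u) (ι (B v))

namespace FormallyAdjoint

variable {ι : V →ₗ[𝕜] E} {A B A' B' : Module.End 𝕜 V}

theorem symm (h : FormallyAdjoint ι A B) : FormallyAdjoint ι B A := fun u v => by
  rw [← inner_conj_symm, ← h, inner_conj_symm]

theorem add (h : FormallyAdjoint ι A B) (h' : FormallyAdjoint ι A' B') :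
    FormallyAdjoint ι (A + A') (B + B') := fun u v => by
  simp only [LinearMap.add_apply, map_add, inner_add_left, inner_add_right, h u v, h' u v]

theorem smul (c : 𝕜) (h : FormallyAdjoint ι A B) :
    FormallyAdjoint ι (c • A) (conj c • B) := fun u v => by
  simp only [LinearMap.smul_apply, map_smul, inner_smul_left, inner_smul_right, h u v]

theorem pow (h : FormallyAdjoint ι A B) (k : ℕ) : FormallyAdjoint ι (A ^ k) (B ^ k) := by
  induction k with
  | zero => exact fun _ _ => rfl
  | succ k ih =>
    intro u v
    rw [pow_succ', Module.End.mul_apply, h, ih, ← Module.End.mul_apply, ← pow_succ]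

end FormallyAdjoint

/-- The `k`-th term of the exponential series of `A` at `v`, in the ambient space `E`. -/
def expTerm (ι : V →ₗ[𝕜] E) (A : Module.End 𝕜 V) (v : V) (k : ℕ) : E :=
  (k ! : 𝕜)⁻¹ • ι ((A ^ k) v)

/-- The vector `e^A v`, the sum of the exponential series in `E` (`0` if the series diverges). -/
def expVec (ι : V →ₗ[𝕜] E) (A : Module.End 𝕜 V) (v : V) : E :=
  ∑' k, expTerm ι A v k

/-- The exponential series of `A` at `v` converges absolutely in `E`. This is Nelson's notion of
an analytic vector, with the exponential taken at time `1`. -/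
def IsAnalyticVector (ι : V →ₗ[𝕜] E) (A : Module.End 𝕜 V) (v : V) : Prop :=
  Summable fun k => ‖expTerm ι A v k‖

variable {ι : V →ₗ[𝕜] E} {A B C : Module.End 𝕜 V} {u v : V}

theorem IsAnalyticVector.hasSum [CompleteSpace E] (h : IsAnalyticVector ι A v) :
    HasSum (expTerm ι A v) (expVec ι A v) :=
  (Summable.of_norm h).hasSum

theorem hasSum_expTerm_zero (v : V) : HasSum (expTerm ι (0 : Module.End 𝕜 V) v) (ι v) := by
  convert! hasSum_single (f := expTerm ι (0 : Module.End 𝕜 V) v) 0 fun k hk => ?_ using 1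
  · simp [expTerm]
  · simp [expTerm, hk]

theorem isAnalyticVector_zero (v : V) : IsAnalyticVector ι (0 : Module.End 𝕜 V) v :=
  summable_of_ne_finset_zero (s := {0}) fun k hk => by simp_all [expTerm]

theorem expVec_zero (v : V) : expVec ι (0 : Module.End 𝕜 V) v = ι v :=
  (hasSum_expTerm_zero v).tsum_eq

theorem sum_antidiagonal_inner_expTerm (hAB : FormallyAdjoint ι A B) (hBC : Commute B C)
    (u v : V) (N : ℕ) :
    ∑ p ∈ Finset.HasAntidiagonal.antidiagonal N, inner 𝕜 (expTerm ι A u p.1) (expTerm ι C v p.2) =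
      inner 𝕜 (ι u) (expTerm ι (B + C) v N) := by
  rw [expTerm, hBC.add_pow', LinearMap.sum_apply, map_sum, Finset.smul_sum, inner_sum]
  refine Finset.sum_congr rfl fun p hp => ?_
  have hchoose : (p.2 ! : 𝕜)⁻¹ * (p.1 ! : 𝕜)⁻¹ = (N ! : 𝕜)⁻¹ * N.choose p.1 := by
    rw [← Finset.HasAntidiagonal.mem_antidiagonal.1 hp, Nat.cast_add_choose]
    field_simp [Nat.factorial_ne_zero]
  simp only [expTerm, inner_smul_left, inner_smul_right, hAB.pow p.1 u, map_inv₀, map_natCast,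
    LinearMap.smul_apply, Module.End.mul_apply, map_smul, ← Nat.cast_smul_eq_nsmul 𝕜]
  rw [← mul_assoc, hchoose, mul_assoc]

theorem hasSum_inner_expVec [CompleteSpace E] (hAB : FormallyAdjoint ι A B) (hBC : Commute B C)
    (hu : IsAnalyticVector ι A u) (hv : IsAnalyticVector ι C v) :
    HasSum (fun N => inner 𝕜 (ι u) (expTerm ι (B + C) v N))
      (inner 𝕜 (expVec ι A u) (expVec ι C v)) := by
  have hsigma := ((Finset.HasAntidiagonal.sigmaAntidiagonalEquivProd.hasSum_iff).2
    (hasSum_inner_prod (𝕜 := 𝕜) hu.hasSum hv.hasSum hu hv)).sigma fun N => hasSum_fintype _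
  refine hsigma.congr_fun fun N => ?_
  rw [← sum_antidiagonal_inner_expTerm hAB hBC]
  exact (Finset.sum_coe_sort (Finset.HasAntidiagonal.antidiagonal N)
    fun p => inner 𝕜 (expTerm ι A u p.1) (expTerm ι C v p.2)).symm

theorem inner_expVec_left [CompleteSpace E] (hAB : FormallyAdjoint ι A B)
    (hu : IsAnalyticVector ι A u) (hv : IsAnalyticVector ι B v) :
    inner 𝕜 (expVec ι A u) (ι v) = inner 𝕜 (ι u) (expVec ι B v) := by
  have h := hasSum_inner_expVec hAB (Commute.zero_right B) hu (isAnalyticVector_zero v)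
  rw [add_zero, expVec_zero] at h
  exact h.unique (hv.hasSum.mapL (innerSL 𝕜 (ι u)))

theorem inner_expVec_expVec_of_skew [CompleteSpace E] (hA : FormallyAdjoint ι A (-A))
    (hu : IsAnalyticVector ι A u) (hv : IsAnalyticVector ι A v) :
    inner 𝕜 (expVec ι A u) (expVec ι A v) = inner 𝕜 (ι u) (ι v) := by
  have h := hasSum_inner_expVec hA (Commute.refl A).neg_left hu hv
  rw [neg_add_cancel] at h
  exact h.unique ((hasSum_expTerm_zero v).mapL (innerSL 𝕜 (ι u)))

end ExpSeries

section HilbertSchmidt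

open ContinuousLinearMap

variable {𝕜 E F G ι κ ν : Type*} [RCLike 𝕜] [NormedAddCommGroup E] [InnerProductSpace 𝕜 E]
  [NormedAddCommGroup F] [InnerProductSpace 𝕜 F] [NormedAddCommGroup G] [InnerProductSpace 𝕜 G]

theorem hasSum_norm_sq_inner (b : HilbertBasis ι 𝕜 E) (x : E) :
    HasSum (fun i => ‖inner 𝕜 (b i) x‖ ^ 2) (‖x‖ ^ 2) := by
  simpa [b.repr_apply_apply] using lp.hasSum_norm (p := 2) (by norm_num) (b.repr x)

theorem ext_hilbertBasis (b : HilbertBasis ι 𝕜 E) {A B : E →L[𝕜] F}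
    (h : ∀ i, A (b i) = B (b i)) : A = B :=
  ContinuousLinearMap.ext_on (Submodule.dense_iff_topologicalClosure_eq_top.2 b.dense_span)
    (Set.eqOn_range.2 (funext h))

theorem ext_inner_hilbertBasis (b : HilbertBasis ι 𝕜 E) {x y : E}
    (h : ∀ i, inner 𝕜 (b i) x = inner 𝕜 (b i) y) : x = y :=
  b.repr.injective <| lp.ext <| funext fun i => by simpa only [b.repr_apply_apply] using h i

theorem inner_map_eq_tsum [CompleteSpace E] [CompleteSpace F] (b : HilbertBasis ι 𝕜 E)
    (A : E →L[𝕜] F) (x : F) (y : E) :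
    inner 𝕜 x (A y) = ∑' i, inner 𝕜 x (A (b i)) * inner 𝕜 (b i) y := by
  simp only [← A.adjoint_inner_left, b.tsum_inner_mul_inner]

/-- The trace of `T` computed in the Hilbert basis `b`. The value is `0` when the diagonal of `T`
is not summable. -/
def diagTrace (b : HilbertBasis ι 𝕜 E) (T : E →L[𝕜] E) : 𝕜 :=
  ∑' i, inner 𝕜 (b i) (T (b i))

theorem diagTrace_star [CompleteSpace E] (b : HilbertBasis ι 𝕜 E) (T : E →L[𝕜] E) :
    diagTrace b (star T) = conj (diagTrace b T) := by
  simp only [diagTrace, RCLike.conj_tsum, inner_conj_symm, star_eq_adjoint, adjoint_inner_right]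

/-- An operator is Hilbert–Schmidt if the squared norms of its columns in the Hilbert basis `b`
are summable. The class of such operators does not depend on `b`. -/
def IsHilbertSchmidt (b : HilbertBasis ι 𝕜 E) (A : E →L[𝕜] F) : Prop :=
  Summable fun i => ‖A (b i)‖ ^ 2

namespace IsHilbertSchmidt

variable {b : HilbertBasis ι 𝕜 E} {A : E →L[𝕜] F}

theorem summable_entries (hA : IsHilbertSchmidt b A) (c : HilbertBasis κ 𝕜 F) :
    Summable fun p : ι × κ => ‖inner 𝕜 (c p.2) (A (b p.1))‖ ^ 2 := by
  refine (summable_prod_of_nonneg fun _ => by positivity).2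
    ⟨fun i => (hasSum_norm_sq_inner c (A (b i))).summable, ?_⟩
  exact hA.congr fun i => (hasSum_norm_sq_inner c (A (b i))).tsum_eq.symm

theorem summable_entries_mul {c : HilbertBasis κ 𝕜 F} {B : F →L[𝕜] E}
    (hA : IsHilbertSchmidt b A) (hB : IsHilbertSchmidt c B) :
    Summable fun p : ι × κ => inner 𝕜 (b p.1) (B (c p.2)) * inner 𝕜 (c p.2) (A (b p.1)) := by
  refine .of_norm_bounded ((hB.summable_entries b).prod_symm.add (hA.summable_entries c))
    fun p => ?_
  rw [norm_mul]
  refine (?_ : ∀ x y : ℝ, x * y ≤ x ^ 2 + y ^ 2) _ _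
  exact fun x y => by nlinarith [sq_nonneg (x - y), sq_nonneg (x + y)]

theorem comp_left (hA : IsHilbertSchmidt b A) (B : F →L[𝕜] G) :
    IsHilbertSchmidt b (B ∘L A) := by
  refine .of_nonneg_of_le (fun _ => by positivity) (fun i => ?_) (hA.mul_left (‖B‖ ^ 2))
  rw [← mul_pow]
  gcongr
  exact B.le_opNorm _

variable [CompleteSpace E] [CompleteSpace F]

theorem adjoint (hA : IsHilbertSchmidt b A) (c : HilbertBasis κ 𝕜 F) :
    IsHilbertSchmidt c A.adjoint := by
  refine ((summable_prod_of_nonneg fun _ => by positivity).1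
    (hA.summable_entries c).prod_symm).2.congr fun k => ?_
  rw [← (hasSum_norm_sq_inner b (A.adjoint (c k))).tsum_eq]
  refine tsum_congr fun i => ?_
  rw [adjoint_inner_right, norm_inner_symm]
  rfl

theorem comp_right [CompleteSpace G] (hA : IsHilbertSchmidt b A) (c : HilbertBasis κ 𝕜 F)
    (d : HilbertBasis ν 𝕜 G) (B : G →L[𝕜] E) : IsHilbertSchmidt d (A ∘L B) := by
  have h := ((hA.adjoint c).comp_left B.adjoint).adjoint d
  rwa [← adjoint_comp, adjoint_adjoint] at h

theorem diagTrace_comp_comm {c : HilbertBasis κ 𝕜 F} {B : F →L[𝕜] E}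
    (hA : IsHilbertSchmidt b A) (hB : IsHilbertSchmidt c B) :
    diagTrace b (B ∘L A) = diagTrace c (A ∘L B) := by
  calc diagTrace b (B ∘L A)
      = ∑' i, ∑' k, inner 𝕜 (b i) (B (c k)) * inner 𝕜 (c k) (A (b i)) :=
        tsum_congr fun i => inner_map_eq_tsum c B (b i) (A (b i))
    _ = ∑' k, ∑' i, inner 𝕜 (b i) (B (c k)) * inner 𝕜 (c k) (A (b i)) :=
        (Summable.tsum_comm (f := fun i k => inner 𝕜 (b i) (B (c k)) * inner 𝕜 (c k) (A (b i)))
          (hA.summable_entries_mul hB)).symm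
    _ = ∑' k, ∑' i, inner 𝕜 (c k) (A (b i)) * inner 𝕜 (b i) (B (c k)) :=
        tsum_congr fun k => tsum_congr fun i => mul_comm _ _
    _ = diagTrace c (A ∘L B) :=
        tsum_congr fun k => (inner_map_eq_tsum b A (c k) (B (c k))).symm

end IsHilbertSchmidt

end HilbertSchmidt

section PositiveTrace

open ContinuousLinearMap

variable {E ι : Type*} [NormedAddCommGroup E] [InnerProductSpace ℂ E] [CompleteSpace E]
  {b : HilbertBasis ι ℂ E} {T : E →L[ℂ] E}

theorem isHilbertSchmidt_sqrt (hT : T.IsPositive)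
    (hs : Summable fun i => inner ℂ (b i) (T (b i))) : IsHilbertSchmidt b (CFC.sqrt T) := by
  have hsa : IsSelfAdjoint (CFC.sqrt T) := (CFC.sqrt_nonneg T).isSelfAdjoint
  have hsq := CFC.sqrt_mul_sqrt_self T ((nonneg_iff_isPositive T).2 hT)
  refine (Complex.reCLM.summable hs).congr fun i => ?_
  nth_rw 1 [← hsq]
  rw [mul_apply_eq_comp, ← adjoint_inner_left, hsa.adjoint_eq]
  exact inner_self_eq_norm_sq (𝕜 := ℂ) _

theorem diagTrace_mul_comm (hT : T.IsPositive)
    (hs : Summable fun i => inner ℂ (b i) (T (b i))) (B : E →L[ℂ] E) :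
    diagTrace b (T * B) = diagTrace b (B * T) := by
  have hR := isHilbertSchmidt_sqrt hT hs
  rw [← CFC.sqrt_mul_sqrt_self T ((nonneg_iff_isPositive T).2 hT)]
  set R := CFC.sqrt T
  rw [mul_assoc, ← mul_assoc B]
  calc diagTrace b (R * (R * B)) = diagTrace b (R * B * R) :=
        (hR.comp_right b b B).diagTrace_comp_comm hR
    _ = diagTrace b (R * (B * R)) := by rw [mul_assoc]
    _ = diagTrace b (B * R * R) := (hR.comp_left B).diagTrace_comp_comm hR

end PositiveTrace

section Antiunitary

variable {𝕜 E F : Type*} [RCLike 𝕜] [NormedAddCommGroup E] [InnerProductSpace 𝕜 E]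
  [NormedAddCommGroup F] [InnerProductSpace 𝕜 F]

theorem inner_map_map_of_antiunitary (J : E →ₗᵢ⋆[𝕜] F) (x y : E) :
    inner 𝕜 (J x) (J y) = conj (inner 𝕜 x y) := by
  have hI : (RCLike.I : 𝕜) • J y = -J ((RCLike.I : 𝕜) • y) := by
    rw [map_smulₛₗ, RCLike.conj_I, neg_smul, neg_neg]
  rw [inner_eq_sum_norm_sq_div_four (J x), inner_eq_sum_norm_sq_div_four x, hI, sub_neg_eq_add,
    ← sub_eq_add_neg, ← map_add, ← map_sub, ← map_add, ← map_sub]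
  simp only [J.norm_map]
  simp only [map_div₀, map_add, map_sub, map_mul, map_pow, RCLike.conj_ofReal,
    RCLike.conj_I, map_ofNat]
  ring

variable {E F : Type*} [NormedAddCommGroup E] [InnerProductSpace ℂ E] [CompleteSpace E]
  [NormedAddCommGroup F] [InnerProductSpace ℂ F] [CompleteSpace F] (J : E ≃ₗᵢ⋆[ℂ] F)

/-- The conjugation `A ↦ J A J⁻¹` of operators by an antiunitary map `J`. It is conjugate-linear,
hence a homomorphism of star algebras only over `ℝ`. -/
def antiunitaryConj : (E →L[ℂ] E) →⋆ₐ[ℝ] (F →L[ℂ] F) where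
  toFun A := (J.toContinuousLinearEquiv : E →L⋆[ℂ] F).comp
    (A.comp (J.symm.toContinuousLinearEquiv : F →L⋆[ℂ] E))
  map_one' := by ext1 x; exact J.apply_symm_apply x
  map_mul' A B := by ext1 x; exact congrArg (J ∘ A) (J.symm_apply_apply (B (J.symm x))).symm
  map_zero' := by ext1; exact map_zero J
  map_add' A B := by ext1; exact map_add J _ _
  commutes' r := by
    ext1 x
    change J ((r : ℂ) • J.symm x) = (r : ℂ) • x
    rw [map_smulₛₗ, J.apply_symm_apply, Complex.conj_ofReal]
  map_star' A := by
    refine (ContinuousLinearMap.eq_adjoint_iff _ _).2 fun x y => ?_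
    obtain ⟨u, rfl⟩ := J.surjective x
    obtain ⟨v, rfl⟩ := J.surjective y
    change inner ℂ (J (A.adjoint (J.symm (J u)))) (J v) = inner ℂ (J u) (J (A (J.symm (J v))))
    have hJ := inner_map_map_of_antiunitary J.toLinearIsometry
    simp only [J.symm_apply_apply, LinearIsometryEquiv.coe_toLinearIsometry] at hJ ⊢
    rw [hJ, hJ, A.adjoint_inner_left]

theorem antiunitaryConj_apply (A : E →L[ℂ] E) (x : F) :
    antiunitaryConj J A x = J (A (J.symm x)) := rfl

theorem inner_antiunitaryConj (A : E →L[ℂ] E) (x y : E) :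
    inner ℂ (J x) (antiunitaryConj J A (J y)) = conj (inner ℂ x (A y)) := by
  rw [antiunitaryConj_apply, J.symm_apply_apply]
  exact inner_map_map_of_antiunitary J.toLinearIsometry x (A y)

theorem continuous_antiunitaryConj : Continuous (antiunitaryConj J) :=
  AddMonoidHomClass.continuous_of_bound _ 1 fun A =>
    ContinuousLinearMap.opNorm_le_bound _ (by positivity) fun x => by
      simpa [antiunitaryConj_apply] using A.le_opNorm (J.symm x)

theorem antiunitaryConj_opNegMulLog {A : E →L[ℂ] E} (hA : IsSelfAdjoint A) :
    antiunitaryConj J (opNegMulLog A) = opNegMulLog (antiunitaryConj J A) :=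
  (antiunitaryConj J).map_cfc Real.negMulLog A Real.continuous_negMulLog.continuousOn
    (continuous_antiunitaryConj J) hA (hA.map _)

theorem isPositive_antiunitaryConj {A : E →L[ℂ] E} (hA : A.IsPositive) :
    (antiunitaryConj J A).IsPositive := by
  refine (ContinuousLinearMap.isPositive_iff' _).2 ⟨hA.isSelfAdjoint.map _, fun x => ?_⟩
  obtain ⟨y, rfl⟩ := J.surjective x
  rw [← inner_conj_symm, inner_antiunitaryConj, Complex.conj_conj]
  exact hA.inner_nonneg_right y

theorem diagTrace_antiunitaryConj {ι : Type*} {b : HilbertBasis ι ℂ E} {c : HilbertBasis ι ℂ F}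
    (hJ : ∀ i, J (b i) = c i) (A : E →L[ℂ] E) :
    diagTrace c (antiunitaryConj J A) = conj (diagTrace b A) := by
  simp only [diagTrace, ← hJ, inner_antiunitaryConj, Complex.conj_tsum]

end Antiunitary

/-- The Fock basis `|n⟩` as a Hilbert basis of the mode space. -/
def fockBasis : HilbertBasis ℕ ℂ ModeSpace := .ofRepr (.refl ℂ ModeSpace)

theorem fockBasis_apply (n : ℕ) : fockBasis n = fock n :=
  (fockBasis.repr_symm_single n).symm

/-- The generator `ξ a† - ξ* a` of the displacement `e^{ξ a† - ξ* a}`. -/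
def displacementGen (ξ : ℂ) : Module.End ℂ FiniteModeSpace :=
  ξ • creation + (-conj ξ) • annihilation

theorem displacementGen_neg (ξ : ℂ) : displacementGen (-ξ) = -displacementGen ξ := by
  rw [displacementGen, displacementGen, map_neg]
  module

theorem displacementGen_single (ξ : ℂ) (n : ℕ) :
    displacementGen ξ (Finsupp.single n 1) =
      (ξ * √(n + 1 : ℕ)) • Finsupp.single (n + 1) 1 -
        (conj ξ * √n) • Finsupp.single (n - 1) 1 := by
  simp only [displacementGen, creation, annihilation, LinearMap.add_apply, LinearMap.smul_apply,
    Finsupp.linearCombination_single, smul_smul, sub_eq_add_neg, neg_mul, neg_smul, one_mul]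

theorem displacementGen_pow_succ_single (ξ : ℂ) (k n : ℕ) :
    (displacementGen ξ ^ (k + 1)) (Finsupp.single n 1) =
      (ξ * √(n + 1 : ℕ)) • (displacementGen ξ ^ k) (Finsupp.single (n + 1) 1) -
        (conj ξ * √n) • (displacementGen ξ ^ k) (Finsupp.single (n - 1) 1) := by
  rw [pow_succ, Module.End.mul_apply, displacementGen_single, map_sub, map_smul, map_smul]

theorem toMode_single (n : ℕ) : FiniteModeSpace.toMode (Finsupp.single n 1) = fock n := by
  simp [FiniteModeSpace.toMode]

theorem formallyAdjoint_creation :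
    FormallyAdjoint FiniteModeSpace.toMode creation annihilation := by
  intro u v
  induction u using Finsupp.induction_linear with
  | zero => simp
  | add u₁ u₂ h₁ h₂ => simp only [map_add, inner_add_left, h₁, h₂]
  | single m c =>
    induction v using Finsupp.induction_linear with
    | zero => simp
    | add v₁ v₂ h₁ h₂ => simp only [map_add, inner_add_right, h₁, h₂]
    | single n d =>
      simp only [creation, annihilation, FiniteModeSpace.toMode, Finsupp.linearCombination_single,
        map_smul, inner_smul_left, inner_smul_right, one_smul, inner_fock, Complex.conj_ofReal]
      rcases n with _ | n
      · simp
      · by_cases h : m = n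
        · simp [h, mul_comm]
        · simp [h]

theorem formallyAdjoint_displacementGen (ξ : ℂ) :
    FormallyAdjoint FiniteModeSpace.toMode (displacementGen ξ) (displacementGen (-ξ)) := by
  have hneg : displacementGen (-ξ) = conj ξ • annihilation + conj (-conj ξ) • creation := by
    rw [displacementGen, map_neg, map_neg, Complex.conj_conj]
    module
  rw [hneg]
  exact (formallyAdjoint_creation.smul ξ).add (formallyAdjoint_creation.symm.smul (-conj ξ))

theorem sqrt_succ_mul_sqrt_ascFactorial (n k : ℕ) :
    √(n + 1 : ℕ) * √((n + 2).ascFactorial k : ℕ) = √((n + 1).ascFactorial (k + 1) : ℕ) := by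
  rw [← Real.sqrt_mul (Nat.cast_nonneg _), ← Nat.cast_mul, Nat.ascFactorial_succ,
    Nat.succ_ascFactorial]

theorem sqrt_mul_sqrt_ascFactorial_pred_le (n k : ℕ) :
    √n * √((n - 1 + 1).ascFactorial k : ℕ) ≤ √((n + 1).ascFactorial (k + 1) : ℕ) := by
  have h : (n - 1 + 1).ascFactorial k ≤ (n + 2).ascFactorial k := Nat.ascFactorial_le k (by lia)
  rw [← sqrt_succ_mul_sqrt_ascFactorial]
  gcongr
  lia

theorem norm_toMode_displacementGen_pow_le (ξ : ℂ) (k n : ℕ) :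
    ‖FiniteModeSpace.toMode ((displacementGen ξ ^ k) (Finsupp.single n 1))‖ ≤
      (2 * ‖ξ‖) ^ k * √((n + 1).ascFactorial k : ℕ) := by
  induction k generalizing n with
  | zero => simp [toMode_single, norm_fock]
  | succ k ih =>
    calc ‖FiniteModeSpace.toMode ((displacementGen ξ ^ (k + 1)) (Finsupp.single n 1))‖
        ≤ ‖ξ‖ * √(n + 1 : ℕ) *
            ‖FiniteModeSpace.toMode ((displacementGen ξ ^ k) (Finsupp.single (n + 1) 1))‖ +
          ‖ξ‖ * √n *
            ‖FiniteModeSpace.toMode ((displacementGen ξ ^ k) (Finsupp.single (n - 1) 1))‖ := by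
          rw [displacementGen_pow_succ_single, map_sub, map_smul, map_smul]
          refine (norm_sub_le _ _).trans_eq ?_
          simp only [norm_smul, norm_mul, RCLike.norm_conj, Complex.norm_real, Real.norm_eq_abs,
            abs_of_nonneg (Real.sqrt_nonneg _)]
      _ ≤ ‖ξ‖ * √(n + 1 : ℕ) * ((2 * ‖ξ‖) ^ k * √((n + 2).ascFactorial k : ℕ)) +
          ‖ξ‖ * √n * ((2 * ‖ξ‖) ^ k * √((n - 1 + 1).ascFactorial k : ℕ)) := by
          gcongr
          exacts [ih (n + 1), ih (n - 1)]
      _ = ‖ξ‖ * (2 * ‖ξ‖) ^ k * (√(n + 1 : ℕ) * √((n + 2).ascFactorial k : ℕ) +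
            √n * √((n - 1 + 1).ascFactorial k : ℕ)) := by ring
      _ ≤ ‖ξ‖ * (2 * ‖ξ‖) ^ k * (√((n + 1).ascFactorial (k + 1) : ℕ) +
            √((n + 1).ascFactorial (k + 1) : ℕ)) := by
          rw [sqrt_succ_mul_sqrt_ascFactorial]
          gcongr
          exact sqrt_mul_sqrt_ascFactorial_pred_le n k
      _ = (2 * ‖ξ‖) ^ (k + 1) * √((n + 1).ascFactorial (k + 1) : ℕ) := by ring

theorem summable_pow_mul_sqrt_ascFactorial_div_factorial (c : ℝ) (n : ℕ) :
    Summable fun k : ℕ => (k ! : ℝ)⁻¹ * (c ^ k * √((n + 1).ascFactorial k : ℕ)) := by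
  have hexp : Summable fun k : ℕ => ((2 * c) ^ 2) ^ k / (k ! : ℝ) :=
    Real.summable_pow_div_factorial _
  have hbin : Summable fun k : ℕ => ((k + n).choose n : ℝ) * (1 / 4) ^ k :=
    summable_choose_mul_geometric_of_norm_lt_one n (by norm_num)
  refine .of_norm_bounded (hexp.add hbin) fun k => ?_
  have hasc : √((n + 1).ascFactorial k : ℕ) = √(k ! : ℝ) * √((k + n).choose n : ℝ) := by
    rw [Nat.ascFactorial_eq_factorial_mul_choose, add_comm n k, Nat.choose_symm_add, Nat.cast_mul,
      Real.sqrt_mul (Nat.cast_nonneg _)]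
  -- AM-GM for the factors `(2 |c|) ^ k / √k!` and `√C(k + n, n) / 2 ^ k`
  have hamgm := two_mul_le_add_sq ((2 * |c|) ^ k / √(k ! : ℝ)) (√((k + n).choose n) * (1 / 2) ^ k)
  have hfact : √(k ! : ℝ) ^ 2 = k ! := Real.sq_sqrt (Nat.cast_nonneg _)
  calc ‖(k ! : ℝ)⁻¹ * (c ^ k * √((n + 1).ascFactorial k : ℕ))‖
      = (2 * |c|) ^ k / √(k ! : ℝ) * (√((k + n).choose n : ℝ) * (1 / 2) ^ k) := by
        rw [norm_mul, norm_mul, norm_inv, norm_pow, Real.norm_natCast, Real.norm_eq_abs,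
          Real.norm_of_nonneg (Real.sqrt_nonneg _), hasc, mul_pow, one_div, inv_pow]
        field_simp
        rw [hfact]
        ring
    _ ≤ ((2 * |c|) ^ k / √(k ! : ℝ)) ^ 2 + (√((k + n).choose n) * (1 / 2) ^ k) ^ 2 := by
        have hnonneg : 0 ≤ (2 * |c|) ^ k / √(k ! : ℝ) * (√((k + n).choose n) * (1 / 2) ^ k) := by
          positivity
        linarith
    _ = ((2 * c) ^ 2) ^ k / (k ! : ℝ) + ((k + n).choose n : ℝ) * (1 / 4) ^ k := by
        rw [div_pow, mul_pow √_, hfact, Real.sq_sqrt (Nat.cast_nonneg _), pow_right_comm,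
          pow_right_comm (1 / 2 : ℝ), mul_pow 2 |c|, sq_abs, ← mul_pow]
        norm_num

theorem isAnalyticVector_displacementGen (ξ : ℂ) (n : ℕ) :
    IsAnalyticVector FiniteModeSpace.toMode (displacementGen ξ) (Finsupp.single n 1) := by
  refine .of_nonneg_of_le (fun _ => norm_nonneg _) (fun k => ?_)
    (summable_pow_mul_sqrt_ascFactorial_div_factorial (2 * ‖ξ‖) n)
  rw [expTerm, norm_smul, norm_inv, Complex.norm_natCast]
  gcongr
  exact norm_toMode_displacementGen_pow_le ξ k n

theorem displacedFock_eq_expVec (ξ : ℂ) (n : ℕ) :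
    displacedFock ξ n =
      expVec FiniteModeSpace.toMode (displacementGen ξ) (Finsupp.single n 1) := rfl

theorem orthonormal_displacedFock (ξ : ℂ) : Orthonormal ℂ (displacedFock ξ) := by
  have hskew := formallyAdjoint_displacementGen ξ
  rw [displacementGen_neg] at hskew
  refine orthonormal_iff_ite.2 fun m n => ?_
  rw [displacedFock_eq_expVec, displacedFock_eq_expVec, inner_expVec_expVec_of_skew hskew
    (isAnalyticVector_displacementGen ξ m) (isAnalyticVector_displacementGen ξ n),
    toMode_single, toMode_single, inner_fock]

theorem inner_displacedFock_left (ξ : ℂ) (m n : ℕ) :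
    inner ℂ (displacedFock ξ m) (fock n) = inner ℂ (fock m) (displacedFock (-ξ) n) := by
  rw [← toMode_single, ← toMode_single]
  exact inner_expVec_left (formallyAdjoint_displacementGen ξ)
    (isAnalyticVector_displacementGen ξ m) (isAnalyticVector_displacementGen (-ξ) n)

/-- The displacement operator `D(ξ) = e^{ξ a† - ξ* a}`: the linear isometry of the mode space that
maps `|n⟩` to `displacedFock ξ n`. -/
def displacement (ξ : ℂ) : ModeSpace →L[ℂ] ModeSpace :=
  (orthonormal_displacedFock ξ).orthogonalFamily.linearIsometry.toContinuousLinearMap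

theorem displacement_fock (ξ : ℂ) (n : ℕ) : displacement ξ (fock n) = displacedFock ξ n := by
  have h := (orthonormal_displacedFock ξ).orthogonalFamily.linearIsometry_apply_single (i := n) 1
  rwa [LinearIsometry.toSpanSingleton_apply, one_smul] at h

theorem star_displacement (ξ : ℂ) : star (displacement ξ) = displacement (-ξ) := by
  refine ext_hilbertBasis fockBasis fun n => ext_inner_hilbertBasis fockBasis fun m => ?_
  simp only [fockBasis_apply, ContinuousLinearMap.star_eq_adjoint,
    ContinuousLinearMap.adjoint_inner_right, displacement_fock, inner_displacedFock_left]

/-- Complex conjugation with respect to the Fock basis. -/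
def modeConj : ModeSpace ≃ₗᵢ⋆[ℂ] ModeSpace := starₗᵢ ℂ

theorem modeConj_symm : modeConj.symm = modeConj := rfl

theorem modeConj_modeConj (x : ModeSpace) : modeConj (modeConj x) = x := star_star x

theorem modeConj_fock (n : ℕ) : modeConj (fock n) = fock n := by
  refine lp.ext (funext fun m => ?_)
  change star (fock n m) = fock n m
  simp only [fock, lp.single_apply, Pi.single_apply]
  split_ifs <;> simp

theorem modeConj_fockBasis (n : ℕ) : modeConj (fockBasis n) = fockBasis n := by
  rw [fockBasis_apply, modeConj_fock]

theorem modeConj_toMode_displacementGen_pow (ξ : ℂ) (k n : ℕ) :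
    modeConj (FiniteModeSpace.toMode ((displacementGen ξ ^ k) (Finsupp.single n 1))) =
      FiniteModeSpace.toMode ((displacementGen (conj ξ) ^ k) (Finsupp.single n 1)) := by
  induction k generalizing n with
  | zero => simp [toMode_single, modeConj_fock]
  | succ k ih =>
    simp only [displacementGen_pow_succ_single, map_sub, map_smul, map_smulₛₗ, ih,
      map_mul, Complex.conj_ofReal]

theorem modeConj_displacedFock (ξ : ℂ) (n : ℕ) :
    modeConj (displacedFock ξ n) = displacedFock (conj ξ) n := by
  refine ((isAnalyticVector_displacementGen ξ n).hasSum.map modeConj modeConj.continuous).unique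
    ((isAnalyticVector_displacementGen (conj ξ) n).hasSum.congr_fun fun k => ?_)
  simp only [Function.comp_apply, expTerm, map_smulₛₗ, modeConj_toMode_displacementGen_pow,
    map_inv₀, map_natCast]

theorem antiunitaryConj_displacement (ξ : ℂ) :
    antiunitaryConj modeConj (displacement ξ) = displacement (conj ξ) := by
  refine ext_hilbertBasis fockBasis fun n => ?_
  rw [antiunitaryConj_apply, modeConj_symm, fockBasis_apply, modeConj_fock, displacement_fock,
    displacement_fock, modeConj_displacedFock]

namespace QState

theorem ext_op {ρ σ : QState} (h : ρ.op = σ.op) : ρ = σ := by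
  cases ρ
  cases σ
  congr

theorem summable_diag (ρ : QState) :
    Summable fun n => inner ℂ (fockBasis n) (ρ.op (fockBasis n))  := by
  simpa only [fockBasis_apply] using ρ.hasTrace_one.summable

theorem charFun_eq_diagTrace (ρ : QState) (ξ : ℂ) :
    ρ.charFun ξ = diagTrace fockBasis (ρ.op * displacement ξ) :=
  tsum_congr fun n => by
    rw [mul_apply_eq_comp, fockBasis_apply, displacement_fock]

/-- The transpose of a state in the Fock basis. It is encoded as the entrywise complex conjugate,
which agrees with the transpose because density operators are self-adjoint. -/
def transpose (ρ : QState) : QState where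
  op := antiunitaryConj modeConj ρ.op
  isPositive := isPositive_antiunitaryConj modeConj ρ.isPositive
  hasTrace_one := by
    have h := ρ.hasTrace_one.map (starRingEnd ℂ) Complex.continuous_conj
    rw [map_one] at h
    refine h.congr_fun fun n => ?_
    rw [Function.comp_apply, ← inner_antiunitaryConj modeConj, modeConj_fock]

theorem transpose_involutive : Function.Involutive transpose := fun ρ =>
  ext_op <| by
    ext1 x
    simp only [transpose, antiunitaryConj_apply, modeConj_symm, modeConj_modeConj]

theorem entropy_transpose (ρ : QState) : ρ.transpose.entropy = ρ.entropy := by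
  refine tsum_congr fun n => ?_
  rw [transpose, ← antiunitaryConj_opNegMulLog _ ρ.isPositive.isSelfAdjoint]
  nth_rw 1 2 [← modeConj_fock n]
  rw [inner_antiunitaryConj, Complex.conj_re]

theorem charFun_transpose (ρ : QState) (ξ : ℂ) :
    ρ.transpose.charFun ξ = ρ.charFun (-conj ξ) := by
  calc ρ.transpose.charFun ξ
      = diagTrace fockBasis (antiunitaryConj modeConj (ρ.op * displacement (conj ξ))) := by
        rw [charFun_eq_diagTrace, map_mul, antiunitaryConj_displacement, Complex.conj_conj]
        rfl
    _ = diagTrace fockBasis (star (ρ.op * displacement (conj ξ))) := by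
        rw [diagTrace_antiunitaryConj modeConj modeConj_fockBasis, diagTrace_star]
    _ = diagTrace fockBasis (displacement (-conj ξ) * ρ.op) := by
        rw [star_mul, star_displacement, ρ.isPositive.isSelfAdjoint.star_eq]
    _ = ρ.charFun (-conj ξ) := by
        rw [← diagTrace_mul_comm ρ.isPositive ρ.summable_diag, charFun_eq_diagTrace]

end QState

theorem transpose_thermalState (nbar : ℝ≥0) :
    (thermalState nbar).transpose = thermalState nbar :=
  QState.ext_op <| ext_hilbertBasis fockBasis fun n => by
    simp only [QState.transpose, thermalState, antiunitaryConj_apply, modeConj_symm, modeConj_fock,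
      fockBasis_apply, thermalOp_apply_fock, map_smulₛₗ, Complex.conj_ofReal]

theorem IsGaugeContravariant.comp_transpose {τ y : ℝ} {Φ : QState → QState}
    (hΦ : IsGaugeContravariant τ y Φ) :
    IsGaugeCovariant |τ| y (Φ ∘ QState.transpose) := by
  obtain ⟨hτ, hy, hchar⟩ := hΦ
  have habs : |(|τ| - 1)| ≤ |τ - 1| := by simpa only [abs_one] using abs_abs_sub_abs_le τ 1
  refine ⟨abs_pos.2 hτ.ne, habs.trans hy, fun ρ ξ => ?_⟩
  rw [Function.comp_apply, hchar, QState.charFun_transpose]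
  simp only [map_neg, map_mul, Complex.conj_ofReal, Complex.conj_conj, neg_neg]

theorem ThermalInputMinimizes.comp_transpose {Φ : QState → QState}
    (hΦ : ThermalInputMinimizes Φ) : ThermalInputMinimizes (Φ ∘ QState.transpose) := by
  intro S₀ nbar hnbar ρ hρ
  rw [Function.comp_apply, transpose_thermalState]
  exact hΦ S₀ nbar hnbar ρ.transpose (ρ.entropy_transpose.trans hρ)

theorem mainTheorem1_general {τ y : ℝ}
    (hcov : ∀ Φ : QState → QState, IsGaugeCovariant |τ| y Φ → ThermalInputMinimizes Φ)
    {Φ : QState → QState} (hΦ : IsGaugeContravariant τ y Φ) : ThermalInputMinimizes Φ := by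
  have h := (hcov _ hΦ.comp_transpose).comp_transpose
  rwa [Function.comp_assoc, QState.transpose_involutive.comp_self, Function.comp_id] at h

end

theorem mainTheorem1
    (hcov : ∀ (τ y : ℝ) (Φ : QState → QState), IsGaugeCovariant τ y Φ → ThermalInputMinimizes Φ) :
    ∀ (τ y : ℝ) (Φ : QState → QState), IsGaugeContravariant τ y Φ → ThermalInputMinimizes Φ :=
  fun _ _ _ hΦ => mainTheorem1_general (hcov _ _) hΦ
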